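/- Let $n,m$ be integers with $n\ge 1$, let $\lambda=(\lambda_1\ge\lambda_2\ge\dots\ge\lambda_n\ge 0)$ be a partition with $\lambda_1+n\le m$, and let $w\in S_n$. Let $S_n$ act on the left on sequences of length $n$ by permuting positions, $(w\mathbf d)_k=d_{w^{-1}(k)}$, so that $s_i$ interchanges the entries $d_i,d_{i+1}$, where $s_i=(i,i+1)$; let $w_0$ be the longest element of $S_n$. *Lascoux atoms.* On $\mathbb Z[\beta][z_1,\dots,z_n]$ let $$\varpi_i f(\mathbf z;\beta)=\frac{(z_i+\beta z_iz_{i+1})f(\mathbf z;\beta)-(z_{i+1}+\beta z_iz_{i+1})f(s_i\mathbf z;\beta)}{z_i-z_{i+1}},\qquad \overline{\varpi}_i=\varpi_i-1,$$ for $1\le i<n$, and let $\overline L_{w\lambda}(\mathbf z;\beta)=\overline\varpi_{i_1}\cdots\overline\varpi_{i_\ell}\,\mathbf z^\lambda$ for a reduced expression $w=s_{i_1}\cdots s_{i_\ell}$ (it is attached to the pair $(w,\lambda)$). *The colored five-vertex model.* Take a grid of $n$ horizontal lines (numbered from top to bottom) and $m$ vertical lines (numbered from left to right), and colors $\mathbf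 c=(c_1>c_2>\dots>c_n>0)$. The edges carry labels in $\{0,c_1,\dots,c_n\}$. The boundary labels are: $0$ on all right and bottom edges; $ww_0\mathbf c$, read from top to bottom, on the left edges; on the top edges, $c_i$ in column $\lambda_{n+1-i}+i$ for $1\le i\le n$, and $0$ in the other columns. A labeling with this boundary is an admissible state if the labels (left, top, right, bottom) at every vertex are one of the following, where $d$ is any color and $c>c'$ are any two colors; a vertex in row $i$ has the indicated weight with $z=z_i$: - $(0,0,0,0)$: weight $1$; - $(0,0,d,d)$: weight $1+\beta z$; - $(c',c',c,c)$, $(c',c,c',c)$, $(d,d,d,d)$: weight $1$; - $(d,0,d,0)$: weight $z$; - $(d,d,0,0)$: weight $1$. Let $\overline{\mathfrak S}_{\lambda,w}$ be the set of admissible states, and let $Z(\overline{\mathfrak S}_{\lambda,w};\mathbf z;\beta)$ be the sum over all states in it of the product of the weights of all vertices. **Theorem.** The polynomial $\overline L_{w\lambda}(\mathbf z;\beta)$ does not depend on the choice of the reduced expression of $w$, and $$\overline L_{w\lambda}(\mathbf z;\beta)=Z(\overline{\mathfrak S}_{\lambda,w};\mathbf z;\beta).$$ -/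

import Mathlib

open MvPolynomial

/-! ### Words in the simple transpositions -/

/-- The simple transposition `s_{i+1} = (i+1, i+2)` of `S_n` (indices of `Fin` start at `0`). -/
def simpleTransposition {n : ℕ} (i : Fin (n - 1)) : Equiv.Perm (Fin n) :=
  Equiv.swap ⟨i.1, by omega⟩ ⟨i.1 + 1, by omega⟩

/-- `ω = [i₁, …, i_ℓ]` is a reduced expression `w = s_{i₁} ⋯ s_{i_ℓ}`: the product is `w` and no
shorter word has product `w`. -/
def IsReducedExpression {n : ℕ} (ω : List (Fin (n - 1))) (w : Equiv.Perm (Fin n)) : Prop :=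
  (ω.map simpleTransposition).prod = w ∧
    ∀ ω' : List (Fin (n - 1)), (ω'.map simpleTransposition).prod = w → ω.length ≤ ω'.length

theorem exists_word {n : ℕ} (w : Equiv.Perm (Fin n)) :
    ∃ ω : List (Fin (n - 1)), (ω.map simpleTransposition).prod = w := by
  cases n with
  | zero => exact ⟨[], Subsingleton.elim _ _⟩
  | succ n =>
    have hw : w ∈ Submonoid.closure
        (Set.range fun i : Fin n => Equiv.swap i.castSucc i.succ) := by
      rw [Equiv.Perm.mclosure_swap_castSucc_succ]; trivial
    induction hw using Submonoid.closure_induction with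
    | mem x hx =>
      obtain ⟨i, rfl⟩ := hx
      exact ⟨[i], by simp [simpleTransposition]; rfl⟩
    | one => exact ⟨[], rfl⟩
    | mul x y _ _ hx hy =>
      obtain ⟨a, rfl⟩ := hx
      obtain ⟨b, rfl⟩ := hy
      exact ⟨a ++ b, by simp⟩

theorem exists_isReducedExpression {n : ℕ} (w : Equiv.Perm (Fin n)) :
    ∃ ω : List (Fin (n - 1)), IsReducedExpression ω w := by
  classical
  have h : ∃ k, ∃ ω : List (Fin (n - 1)),
      (ω.map simpleTransposition).prod = w ∧ ω.length = k := by
    obtain ⟨ω, hω⟩ := exists_word w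
    exact ⟨_, ω, hω, rfl⟩
  obtain ⟨ω, hω, hl⟩ := Nat.find_spec h
  exact ⟨ω, hω, fun ω' h' => hl ▸ Nat.find_min' h ⟨ω', h', rfl⟩⟩

/-! ### Demazure–Lascoux operators and Lascoux atoms -/

/-- The ring `ℤ[β][z₁, …, z_n]`. -/
abbrev BetaPoly (n : ℕ) : Type := MvPolynomial (Fin n) (Polynomial ℤ)

/-- The indeterminate `β`. -/
noncomputable def betaVar (n : ℕ) : BetaPoly n := C Polynomial.X

/-- `f(s_i 𝐳; β)`: interchange `z_i` and `z_{i+1}` in `f`. -/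
noncomputable def swapVars {n : ℕ} (i : Fin (n - 1)) (f : BetaPoly n) : BetaPoly n :=
  rename (simpleTransposition i) f

/-- The variable `z_i`. -/
noncomputable def zLeft {n : ℕ} (i : Fin (n - 1)) : BetaPoly n := X ⟨i.1, by omega⟩

/-- The variable `z_{i+1}`. -/
noncomputable def zRight {n : ℕ} (i : Fin (n - 1)) : BetaPoly n := X ⟨i.1 + 1, by omega⟩

/-- The numerator of `ϖ_i f`. -/
noncomputable def demazureLascouxNumerator {n : ℕ} (i : Fin (n - 1)) (f : BetaPoly n) :
    BetaPoly n :=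
  (zLeft i + betaVar n * zLeft i * zRight i) * f -
    (zRight i + betaVar n * zLeft i * zRight i) * swapVars i f

theorem sub_dvd_sub_swapVars {n : ℕ} (i : Fin (n - 1)) (f : BetaPoly n) :
    zLeft i - zRight i ∣ f - swapVars i f := by
  induction f using MvPolynomial.induction_on with
  | C a => simp [swapVars]
  | add p q hp hq =>
    have : p + q - swapVars i (p + q) = (p - swapVars i p) + (q - swapVars i q) := by
      simp only [swapVars, map_add]; ring
    rw [this]; exact dvd_add hp hq
  | mul_X p k hp =>
    have e : p * X k - swapVars i (p * X k) =
        (p - swapVars i p) * X k + swapVars i p * (X k - X (simpleTransposition i k)) := by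
      simp only [swapVars, map_mul, rename_X]; ring
    rw [e]
    refine dvd_add (hp.mul_right _) (Dvd.dvd.mul_left ?_ _)
    unfold simpleTransposition zLeft zRight
    rw [Equiv.swap_apply_def]
    split_ifs with h1 h2
    · rw [h1]
    · rw [h2]; exact (dvd_sub_comm).mp dvd_rfl
    · simp

theorem sub_dvd_demazureLascouxNumerator {n : ℕ} (i : Fin (n - 1)) (f : BetaPoly n) :
    zLeft i - zRight i ∣ demazureLascouxNumerator i f := by
  have e : demazureLascouxNumerator i f =
      (zLeft i + betaVar n * zLeft i * zRight i) * (f - swapVars i f) +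
        (zLeft i - zRight i) * swapVars i f := by
    unfold demazureLascouxNumerator; ring
  rw [e]
  exact dvd_add ((sub_dvd_sub_swapVars i f).mul_left _) (dvd_mul_right _ _)

/-- The Demazure–Lascoux operator `ϖ_i`: the polynomial quotient of the numerator by
`z_i - z_{i+1}` (it exists by the lemma above, and is unique since the ring is a domain). -/
noncomputable def demazureLascoux {n : ℕ} (i : Fin (n - 1)) (f : BetaPoly n) : BetaPoly n :=
  (sub_dvd_demazureLascouxNumerator i f).choose

theorem demazureLascoux_spec {n : ℕ} (i : Fin (n - 1)) (f : BetaPoly n) :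
    (zLeft i - zRight i) * demazureLascoux i f =
      (zLeft i + betaVar n * zLeft i * zRight i) * f -
        (zRight i + betaVar n * zLeft i * zRight i) * swapVars i f :=
  (sub_dvd_demazureLascouxNumerator i f).choose_spec.symm

/-- The Demazure–Lascoux atom operator `ϖ̄_i = ϖ_i - 1`. -/
noncomputable def atomOperator {n : ℕ} (i : Fin (n - 1)) (f : BetaPoly n) : BetaPoly n :=
  demazureLascoux i f - f

/-- `ϖ̄_{i₁} ϖ̄_{i₂} ⋯ ϖ̄_{i_ℓ} f` (the rightmost operator is applied first). -/
noncomputable def atomOperatorWord {n : ℕ} (ω : List (Fin (n - 1))) (f : BetaPoly n) :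
    BetaPoly n :=
  ω.foldr atomOperator f

/-- The monomial `𝐳^λ`. -/
noncomputable def zPow {n : ℕ} (lam : Fin n → ℕ) : BetaPoly n := ∏ i, X i ^ lam i

/-- The Lascoux atom `L̄_{wλ}(𝐳; β) = ϖ̄_w 𝐳^λ`, where `ϖ̄_w` is computed from some reduced
expression of `w`. -/
noncomputable def lascouxAtom {n : ℕ} (lam : Fin n → ℕ) (w : Equiv.Perm (Fin n)) : BetaPoly n :=
  atomOperatorWord (exists_isReducedExpression w).choose (zPow lam)

/-! ### The colored five-vertex model -/

/-- Edge labels `{0, c₁, …, c_n}`: `none` is `0`, and `some i` is the color `c_{i+1}`.  As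
`c₁ > c₂ > ⋯ > c_n`, the color `some i` is larger than the color `some j` iff `i < j`. -/
abbrev EdgeLabel (n : ℕ) : Type := Option (Fin n)

/-- The admissible local configurations, in the order left, top, right, bottom. -/
inductive AdmissibleVertex {n : ℕ} :
    EdgeLabel n → EdgeLabel n → EdgeLabel n → EdgeLabel n → Prop
  | a1 : AdmissibleVertex none none none none
  | a2 (d : Fin n) : AdmissibleVertex none none (some d) (some d)
  | b1 (i j : Fin n) (h : i < j) : AdmissibleVertex (some j) (some j) (some i) (some i)
  | b1dagger (i j : Fin n) (h : i < j) : AdmissibleVertex (some j) (some i) (some j) (some i)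
  | b1circ (d : Fin n) : AdmissibleVertex (some d) (some d) (some d) (some d)
  | b2 (d : Fin n) : AdmissibleVertex (some d) none (some d) none
  | c1 (d : Fin n) : AdmissibleVertex (some d) (some d) none none

open Classical in
/-- The Boltzmann weight of a vertex with spectral parameter `z` and labels left, top, right,
bottom: `1 + β z` for type `a₂`, `z` for type `b₂`, `1` for the other admissible configurations,
and `0` for inadmissible ones. -/
noncomputable def vertexWeight {n : ℕ} {R : Type*} [CommRing R] (β z : R)
    (l t r b : EdgeLabel n) : R :=
  if AdmissibleVertex l t r b then
    if l = none ∧ t = none ∧ r ≠ none then 1 + β * z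
    else if l ≠ none ∧ t = none then z
    else 1
  else 0

/-- An assignment of labels to the edges of the grid with `n` horizontal lines (numbered from the
top) and `m` vertical lines (numbered from the left).  The label of the `k`-th horizontal edge of
row `r` is `horiz r k`, and that of the vertical edge above row `r` in column `k` is `vert r k`
(for `r = n`, the bottom edge). -/
abbrev Labeling (n m : ℕ) : Type :=
  (Fin n → Fin (m + 1) → EdgeLabel n) × (Fin (n + 1) → Fin m → EdgeLabel n)

namespace Labeling

def horiz {n m : ℕ} (S : Labeling n m) : Fin n → Fin (m + 1) → EdgeLabel n := S.1

def vert {n m : ℕ} (S : Labeling n m) : Fin (n + 1) → Fin m → EdgeLabel n := S.2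

end Labeling

/-- The action of `S_n` on sequences of length `n` by permuting positions,
`(w d)_k = d_{w⁻¹(k)}`; in particular `s_i d` interchanges the entries `d_i` and `d_{i+1}`. -/
def permuteSeq {n : ℕ} {α : Type*} (w : Equiv.Perm (Fin n)) (d : Fin n → α) : Fin n → α :=
  fun k => d (w⁻¹ k)

/-- The boundary conditions: from top to bottom the left edges are `w w₀ 𝐜`; the right and bottom
edges are `0`; on the top edges, the color `c_i` is in column `λ_{n+1-i} + i` (the position of the
`i`-th `1` from the left in the `{0,1}`-sequence of `λ`) and the other top edges are `0`.
The longest element `w₀` is `Fin.revPerm`. -/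
def HasBoundary {n m : ℕ} (lam : Fin n → ℕ) (w : Equiv.Perm (Fin n)) (S : Labeling n m) : Prop :=
  (∀ r : Fin n,
    S.horiz r 0 = permuteSeq (w * Fin.revPerm) (fun i : Fin n => (some i : EdgeLabel n)) r) ∧
  (∀ r : Fin n, S.horiz r (Fin.last m) = none) ∧
  (∀ k : Fin m, S.vert (Fin.last n) k = none) ∧
  (∀ (k : Fin m) (i : Fin n), S.vert 0 k = some i ↔ (k : ℕ) = lam i.rev + i)

/-- All vertices of the labeled grid are admissible. -/
def IsAdmissible {n m : ℕ} (S : Labeling n m) : Prop :=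
  ∀ (r : Fin n) (k : Fin m), AdmissibleVertex
    (S.horiz r k.castSucc) (S.vert r.castSucc k) (S.horiz r k.succ) (S.vert r.succ k)

open Classical in
/-- The set of admissible states of the colored model attached to `λ` and `w`, on a grid with
`m` columns. -/
noncomputable def coloredStates {n : ℕ} (m : ℕ) (lam : Fin n → ℕ) (w : Equiv.Perm (Fin n)) :
    Finset (Labeling n m) :=
  Finset.univ.filter fun S => HasBoundary lam w S ∧ IsAdmissible S

/-- The Boltzmann weight of a state, with spectral parameter `z_r` in row `r`. -/
noncomputable def stateWeight {n m : ℕ} {R : Type*} [CommRing R] (z : Fin n → R) (β : R)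
    (S : Labeling n m) : R :=
  ∏ r : Fin n, ∏ k : Fin m, vertexWeight β (z r)
    (S.horiz r k.castSucc) (S.vert r.castSucc k) (S.horiz r k.succ) (S.vert r.succ k)

/-- The partition function `Z(𝔖; 𝐳; β)` of a set of states. -/
noncomputable def partitionFunction {n m : ℕ} {R : Type*} [CommRing R]
    (model : Finset (Labeling n m)) (z : Fin n → R) (β : R) : R :=
  ∑ S ∈ model, stateWeight z β S

/-!
Paths in a state run to the right and upwards, so every vertex, as well as the R-matrix below,
preserves the multiset of labels that pass through it.

**Recursion.** For two rows with parameters `x` (above) and `y`, there is an R-matrix on pairs of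
labels that intertwines the columns of two vertices with parameters `(x, y)` and `(y, x)`
(`yangBaxter`). Attaching it to the left edges of two adjacent rows and moving it through all
columns to the right edges, where all labels are `0`, gives a three-term relation between products
of transfer matrices (`rowMatrix_mul_rowMatrix_exchange`). Divided by `z_i - z_{i+1}`, it says that
`ϖ̄_i` interchanges the left labels of rows `i` and `i + 1` if the larger color is below, that is,
if passing from `u` to `s_i u` creates an inversion (`atomOperator_partitionFunction`).

**Initial value.** For `w = 1` the colors enter in increasing order from top to bottom. The color
that enters the top row is then the smallest one and has the rightmost column on the top boundary.
This forces it straight to that column, and the number of empty columns on its way is `λ_1`; by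
induction on the rows there is a single state, of weight `𝐳^λ`
(`partitionFunction_coloredStates_one`).

Every letter of a reduced word, read from the right, creates an inversion
(`IsReducedExpression.of_cons`). Hence `ϖ̄_{i₁} ⋯ ϖ̄_{i_ℓ} 𝐳^λ` is the partition function for every
reduced word, and the independence of the word is a consequence.
-/

/-! ### Reduced words -/

/-- The exchange property: a word for `u` whose inverse reverses the order of `a < b` has a letter
whose deletion gives a word for `(a b) u`. -/
theorem exists_shorter_word_swap_mul {n : ℕ} (ω : List (Fin (n - 1))) {a b : Fin n} (hab : a < b)
    (h : (ω.map simpleTransposition).prod⁻¹ b < (ω.map simpleTransposition).prod⁻¹ a) :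
    ∃ ω' : List (Fin (n - 1)), ω'.length + 1 = ω.length ∧
      (ω'.map simpleTransposition).prod
        = Equiv.swap a b * (ω.map simpleTransposition).prod := by
  induction ω generalizing a b with
  | nil => simp at h; exact absurd h (not_lt.mpr hab.le)
  | cons j ω ih =>
    set u := (ω.map simpleTransposition).prod with hu
    have hj : (simpleTransposition j)⁻¹ = simpleTransposition j := by simp [simpleTransposition]
    have hinv : ∀ k, ((List.map simpleTransposition (j :: ω)).prod)⁻¹ k
        = u⁻¹ (simpleTransposition j k) := by
      intro k
      simp [List.map_cons, List.prod_cons, mul_inv_rev, hj, ← hu]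
    by_cases hc : simpleTransposition j a < simpleTransposition j b
    · rw [hinv, hinv] at h
      obtain ⟨ω', hl, hp⟩ := ih hc h
      refine ⟨j :: ω', by simp [hl], ?_⟩
      rw [List.map_cons, List.prod_cons, hp, List.map_cons, List.prod_cons, ← hu, ← mul_assoc,
        ← mul_assoc, Equiv.swap_apply_apply, hj, ← mul_assoc, ← mul_assoc]
      simp [simpleTransposition]
    · refine ⟨ω, by simp, ?_⟩
      -- a simple transposition reverses the order of no pair but its own
      have : Equiv.swap a b = simpleTransposition j := by
        have h1 : a = ⟨j.1, by omega⟩ ∧ b = ⟨j.1 + 1, by omega⟩ := by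
          unfold simpleTransposition at hc
          rw [Equiv.swap_apply_def, Equiv.swap_apply_def] at hc
          simp only [Fin.ext_iff, Fin.lt_def] at hc hab ⊢
          split_ifs at hc <;> simp_all <;> omega
        rw [h1.1, h1.2]; rfl
      rw [List.map_cons, List.prod_cons, ← hu, this, ← mul_assoc]
      simp [simpleTransposition]

/-- The tail of a reduced word is reduced, and its first letter creates an inversion. -/
theorem IsReducedExpression.of_cons {n : ℕ} {i : Fin (n - 1)} {ω : List (Fin (n - 1))}
    {w : Equiv.Perm (Fin n)} (h : IsReducedExpression (i :: ω) w) :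
    ∃ u, IsReducedExpression ω u ∧ w = simpleTransposition i * u ∧
      u⁻¹ ⟨i.1, by omega⟩ < u⁻¹ ⟨i.1 + 1, by omega⟩ := by
  obtain ⟨hw, hmin⟩ := h
  refine ⟨_, ⟨rfl, fun ω' h' => ?_⟩, by simpa using hw.symm, ?_⟩
  · have := hmin (i :: ω') (by rw [← hw]; simp [h'])
    simpa using this
  · by_contra hlt
    have hne : (⟨i.1, by omega⟩ : Fin n) ≠ ⟨i.1 + 1, by omega⟩ := by simp [Fin.ext_iff]
    obtain ⟨ω', hl, hp⟩ := exists_shorter_word_swap_mul ω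
      (a := ⟨i.1, by omega⟩) (b := ⟨i.1 + 1, by omega⟩) (by simp [Fin.lt_def])
      (lt_of_le_of_ne (not_lt.mp hlt) (fun e => hne ((Equiv.injective _ e).symm)))
    have := hmin ω' (by rw [hp, ← hw]; simp [simpleTransposition])
    simp at this; omega

/-! ### Products of lists of matrices -/

section Products

variable {R : Type*} [CommRing R]

/-- An entry of a product of matrices is a sum over paths of indices. -/
theorem prod_ofFn_apply {I : Type*} [Fintype I] [DecidableEq I] {k : ℕ}
    (M : Fin k → Matrix I I R) (a b : I) :
    (List.ofFn M).prod a b = ∑ v : Fin (k + 1) → I,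
      if v 0 = a ∧ v (Fin.last k) = b then ∏ r, M r (v r.castSucc) (v r.succ) else 0 := by
  induction k generalizing a b with
  | zero =>
    rw [← (Equiv.funUnique (Fin 1) I).symm.sum_comp]
    simp only [List.ofFn_zero, List.prod_nil, Matrix.one_apply, Finset.univ_eq_empty,
      Finset.prod_empty, Fin.last_zero]
    simp [ite_and]
  | succ k ih =>
    rw [List.ofFn_succ, List.prod_cons, Matrix.mul_apply,
      ← (Fin.consEquiv (fun _ : Fin (k + 2) => I)).sum_comp, Fintype.sum_prod_type]
    simp only [ih, Finset.mul_sum, Fin.consEquiv_apply, Fin.prod_univ_succ, ← Fin.succ_last,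
      Fin.cons_zero, Fin.cons_succ, Fin.castSucc_zero, ← Fin.succ_castSucc]
    rw [Finset.sum_comm]
    conv_rhs => rw [Finset.sum_comm]
    refine Finset.sum_congr rfl fun v _ => ?_
    simp only [ite_and, mul_ite, mul_zero]
    simp

/-- The distributive law for products of noncommuting sums. -/
theorem sum_prod_ofFn {A C : Type*} [Semiring A] [Fintype C] {k : ℕ} (F : Fin k → C → A) :
    ∑ U : Fin k → C, (List.ofFn fun j => F j (U j)).prod
      = (List.ofFn fun j => ∑ c, F j c).prod := by
  induction k with
  | zero => simp
  | succ k ih =>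
    rw [← (Fin.consEquiv (fun _ : Fin (k + 1) => C)).sum_comp, Fintype.sum_prod_type]
    simp [List.ofFn_succ, ← ih, Finset.sum_mul_sum]

open scoped Kronecker in
theorem prod_ofFn_kronecker {I J : Type*} [Fintype I] [DecidableEq I] [Fintype J] [DecidableEq J]
    {k : ℕ} (f : Fin k → Matrix I I R) (g : Fin k → Matrix J J R) :
    (List.ofFn f).prod ⊗ₖ (List.ofFn g).prod = (List.ofFn fun j => f j ⊗ₖ g j).prod := by
  induction k with
  | zero => simp
  | succ k ih => simp [List.ofFn_succ, ← ih, Matrix.mul_kronecker_mul]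

theorem SemiconjBy.prod_ofFn {A : Type*} [Monoid A] {k : ℕ} {r : A} {f g : Fin k → A}
    (h : ∀ j, SemiconjBy r (f j) (g j)) :
    SemiconjBy r (List.ofFn f).prod (List.ofFn g).prod := by
  induction k with
  | zero => simp
  | succ k ih =>
    rw [List.ofFn_succ, List.ofFn_succ, List.prod_cons, List.prod_cons]
    exact (h 0).mul_right (ih fun j => h j.succ)

/-- A linear relation between the products of two adjacent factors passes to the full products,
if the remaining factors agree. -/
theorem smul_prod_ofFn_of_adjacent {A : Type*} [Ring A] [Algebra R A] {n : ℕ}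
    (i : ℕ) (hi : i + 1 < n) (f g h : Fin n → A) (c d e : R)
    (hg : ∀ j : Fin n, j.1 ≠ i → j.1 ≠ i + 1 → g j = f j)
    (hh : ∀ j : Fin n, j.1 ≠ i → j.1 ≠ i + 1 → h j = f j)
    (hf : c • (f ⟨i, by omega⟩ * f ⟨i + 1, hi⟩)
      = d • (g ⟨i, by omega⟩ * g ⟨i + 1, hi⟩) + e • (h ⟨i, by omega⟩ * h ⟨i + 1, hi⟩)) :
    c • (List.ofFn f).prod = d • (List.ofFn g).prod + e • (List.ofFn h).prod := by
  induction i generalizing n with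
  | zero =>
    obtain ⟨n, rfl⟩ : ∃ k, n = k + 2 := ⟨n - 2, by omega⟩
    have hg' : (fun j : Fin n => g j.succ.succ) = fun j => f j.succ.succ :=
      funext fun j => hg _ (by simp) (by simp)
    have hh' : (fun j : Fin n => h j.succ.succ) = fun j => f j.succ.succ :=
      funext fun j => hh _ (by simp) (by simp)
    simp only [List.ofFn_succ, List.prod_cons, hg', hh', ← mul_assoc, ← smul_mul_assoc, ← add_mul]
    congr 1
    rw [smul_mul_assoc, smul_mul_assoc, smul_mul_assoc]
    exact hf
  | succ i ih =>
    obtain ⟨n, rfl⟩ : ∃ k, n = k + 1 := ⟨n - 1, by omega⟩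
    have key := ih (n := n) (by omega) (fun j => f j.succ) (fun j => g j.succ) (fun j => h j.succ)
      (fun j h1 h2 => hg _ (by simpa using h1) (by simpa using h2))
      (fun j h1 h2 => hh _ (by simpa using h1) (by simpa using h2)) (by simpa using hf)
    rw [List.ofFn_succ, List.ofFn_succ, List.ofFn_succ, List.prod_cons, List.prod_cons,
      List.prod_cons, hg 0 (by simp) (by simp), hh 0 (by simp) (by simp), ← mul_smul_comm, key,
      mul_add, mul_smul_comm, mul_smul_comm]

end Products

/-! ### The Yang–Baxter equation -/

section YangBaxter

variable {n : ℕ} {R : Type*} [CommRing R]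

/-- The paths in a state run to the right and upwards.  `passWeight z l b` is the weight of a
vertex at which the path with label `l` from the left leaves to the right and the path with label
`b` from below leaves upwards; if `l = b`, it is the whole weight of the vertex. -/
def passWeight (z : R) : EdgeLabel n → EdgeLabel n → R
  | none, none => 1
  | none, some _ => 0
  | some _, none => z
  | some j, some i => if i ≤ j then 1 else 0

/-- The weight of a vertex at which the path with label `l` from the left leaves upwards and the
path with label `b` from below leaves to the right; it is taken to be `0` if `l = b`. -/
def turnWeight (β z : R) : EdgeLabel n → EdgeLabel n → R
  | none, none => 0
  | none, some _ => 1 + β * z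
  | some _, none => 1
  | some j, some i => if i < j then 1 else 0

/-- The entry of the R-matrix from `(p, q)` to `(p, q)`. -/
def rPassWeight (β x y : R) : EdgeLabel n → EdgeLabel n → R
  | none, none => y * (1 + β * x)
  | none, some _ => y * (1 + β * y)
  | some _, none => y * (1 + β * x)
  | some j, some i => if i ≤ j then y * (1 + β * x) else x * (1 + β * y)

/-- The entry of the R-matrix from `(p, q)` to `(q, p)`, or `0` if `p = q`. -/
def rTurnWeight (x y : R) : EdgeLabel n → EdgeLabel n → R
  | none, _ => 0
  | some _, none => (y - x) * y
  | some j, some i => if i < j then y - x else 0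

/-- The Kronecker delta, with values in `R`. -/
def labelDelta (R : Type*) [CommRing R] (a b : EdgeLabel n) : R := if a = b then 1 else 0

theorem sum_labelDelta_mul (a : EdgeLabel n) (f : EdgeLabel n → R) :
    ∑ c, labelDelta R c a * f c = f a := by
  simp [labelDelta]

/-- The vertex as a matrix from the left label to the right label, for given top and bottom
labels. -/
noncomputable def vertexMatrix (β z : R) (t b : EdgeLabel n) :
    Matrix (EdgeLabel n) (EdgeLabel n) R :=
  Matrix.of fun l r => vertexWeight β z l t r b

theorem admissibleVertex_iff (l t r b : EdgeLabel n) : AdmissibleVertex l t r b ↔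
    (l = none ∧ t = none ∧ r = b) ∨ (∃ d, l = some d ∧ t = some d ∧ r = none ∧ b = none) ∨
    (∃ d, l = some d ∧ t = none ∧ r = some d ∧ b = none) ∨
    (∃ i j, i ≤ j ∧ l = some j ∧ t = some j ∧ r = some i ∧ b = some i) ∨
    (∃ i j, i < j ∧ l = some j ∧ t = some i ∧ r = some j ∧ b = some i) := by
  constructor
  · intro h
    cases h <;> simp_all [le_of_lt]
  · rintro (⟨rfl, rfl, rfl⟩ | ⟨d, rfl, rfl, rfl, rfl⟩ | ⟨d, rfl, rfl, rfl, rfl⟩ |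
      ⟨i, j, h, rfl, rfl, rfl, rfl⟩ | ⟨i, j, h, rfl, rfl, rfl, rfl⟩)
    · cases r with
      | none => exact .a1
      | some d => exact .a2 d
    · exact .c1 d
    · exact .b2 d
    · rcases h.eq_or_lt with rfl | h
      · exact .b1circ i
      · exact .b1 i j h
    · exact .b1dagger i j h

theorem vertexWeight_eq (β z : R) (l t r b : EdgeLabel n) :
    vertexWeight β z l t r b =
      passWeight z l b * labelDelta R r l * labelDelta R t b +
        turnWeight β z l b * labelDelta R r b * labelDelta R t l := by
  unfold vertexWeight
  rw [admissibleVertex_iff]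
  rcases l with _ | l <;> rcases t with _ | t <;> rcases r with _ | r <;> rcases b with _ | b <;>
    simp only [passWeight, turnWeight, labelDelta] <;> simp
  all_goals try (split_ifs <;> simp_all)
  all_goals grind

open scoped Kronecker in
/-- Two vertices on top of each other, with parameters `x` (above) and `y`, as a matrix from the
pair of left labels to the pair of right labels; the label of the edge between them is summed
over. -/
noncomputable def columnMatrix (β x y : R) (t b : EdgeLabel n) :
    Matrix (EdgeLabel n × EdgeLabel n) (EdgeLabel n × EdgeLabel n) R :=
  ∑ c, vertexMatrix β x t c ⊗ₖ vertexMatrix β y c b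

/-- The R-matrix. -/
def rMatrix (n : ℕ) (β x y : R) :
    Matrix (EdgeLabel n × EdgeLabel n) (EdgeLabel n × EdgeLabel n) R :=
  Matrix.of fun p r =>
    rPassWeight β x y p.1 p.2 * labelDelta R r.1 p.1 * labelDelta R r.2 p.2 +
      rTurnWeight x y p.1 p.2 * labelDelta R r.1 p.2 * labelDelta R r.2 p.1

theorem labelDelta_comm (a b : EdgeLabel n) : labelDelta R a b = labelDelta R b a := by
  simp [labelDelta, eq_comm]

theorem columnMatrix_apply (β x y : R) (t b p q r s : EdgeLabel n) :
    columnMatrix β x y t b (p, q) (r, s) =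
      passWeight y q b * labelDelta R s q *
        (passWeight x p b * labelDelta R r p * labelDelta R t b +
          turnWeight β x p b * labelDelta R r b * labelDelta R t p) +
      turnWeight β y q b * labelDelta R s b *
        (passWeight x p q * labelDelta R r p * labelDelta R t q +
          turnWeight β x p q * labelDelta R r q * labelDelta R t p) := by
  simp only [← vertexWeight_eq]
  rw [columnMatrix, Matrix.sum_apply]
  simp only [Matrix.kroneckerMap_apply, vertexMatrix, Matrix.of_apply]
  rw [← sum_labelDelta_mul b fun c => passWeight y q b * labelDelta R s q * vertexWeight β x p t r c,
    ← sum_labelDelta_mul q fun c => turnWeight β y q b * labelDelta R s b * vertexWeight β x p t r c,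
    ← Finset.sum_add_distrib]
  refine Finset.sum_congr rfl fun c _ => ?_
  rw [vertexWeight_eq β y]
  ring

theorem rMatrix_mul_apply (β x y : R) (p q : EdgeLabel n)
    (K : Matrix (EdgeLabel n × EdgeLabel n) (EdgeLabel n × EdgeLabel n) R)
    (rs : EdgeLabel n × EdgeLabel n) :
    (rMatrix n β x y * K) (p, q) rs =
      rPassWeight β x y p q * K (p, q) rs + rTurnWeight x y p q * K (q, p) rs := by
  rw [Matrix.mul_apply, Fintype.sum_prod_type]
  simp only [rMatrix, Matrix.of_apply, add_mul, Finset.sum_add_distrib]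
  simp [labelDelta]

theorem sum_labelDelta_mul_rMatrix (β x y : R) (a b r s : EdgeLabel n) :
    ∑ r', ∑ s', labelDelta R r' a * labelDelta R s' b * rMatrix n β x y (r', s') (r, s) =
      rPassWeight β x y a b * labelDelta R r a * labelDelta R s b +
        rTurnWeight x y a b * labelDelta R r b * labelDelta R s a := by
  simp only [mul_assoc, ← Finset.mul_sum, sum_labelDelta_mul]
  simp [rMatrix, mul_assoc]

/-- The Yang–Baxter equation: the R-matrix may be moved from the left to the right of a column of
two vertices, interchanging their parameters.  Both sides are combinations of the ways of sending
the labels `p, q, b` that enter to the exits `r, s, t`; the coefficients are compared for each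
relative order of `p, q, b`. -/
theorem yangBaxter (β x y : R) (t b : EdgeLabel n) :
    SemiconjBy (rMatrix n β x y) (columnMatrix β x y t b) (columnMatrix β y x t b) := by
  ext ⟨p, q⟩ ⟨r, s⟩
  -- the four ways through the column, each followed by the R-matrix on the labels that come out
  have h : (columnMatrix β y x t b * rMatrix n β x y) (p, q) (r, s) =
      passWeight x q b * passWeight y p b * labelDelta R t b *
        (rPassWeight β x y p q * labelDelta R r p * labelDelta R s q +
          rTurnWeight x y p q * labelDelta R r q * labelDelta R s p) +
      passWeight x q b * turnWeight β y p b * labelDelta R t p *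
        (rPassWeight β x y b q * labelDelta R r b * labelDelta R s q +
          rTurnWeight x y b q * labelDelta R r q * labelDelta R s b) +
      turnWeight β x q b * passWeight y p q * labelDelta R t q *
        (rPassWeight β x y p b * labelDelta R r p * labelDelta R s b +
          rTurnWeight x y p b * labelDelta R r b * labelDelta R s p) +
      turnWeight β x q b * turnWeight β y p q * labelDelta R t p *
        (rPassWeight β x y q b * labelDelta R r q * labelDelta R s b +
          rTurnWeight x y q b * labelDelta R r b * labelDelta R s q) := by
    simp only [← sum_labelDelta_mul_rMatrix, Finset.mul_sum, ← Finset.sum_add_distrib]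
    rw [Matrix.mul_apply, Fintype.sum_prod_type]
    refine Finset.sum_congr rfl fun r' _ => Finset.sum_congr rfl fun s' _ => ?_
    rw [columnMatrix_apply]
    ring
  rw [h, rMatrix_mul_apply, columnMatrix_apply, columnMatrix_apply]
  clear h
  rcases p with _ | p <;> rcases q with _ | q <;> rcases b with _ | b <;>
    simp only [passWeight, turnWeight, rPassWeight, rTurnWeight]
  · ring
  · ring
  · ring
  · rcases lt_trichotomy q b with h | rfl | h
    · simp only [h.le, h, h.not_gt, h.not_ge, if_true, if_false]; ring
    · simp only [le_refl, lt_irrefl, if_true, if_false]; ring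
    · simp only [h.le, h, h.not_gt, h.not_ge, if_true, if_false]; ring
  · ring
  · rcases lt_trichotomy p b with h | rfl | h
    · simp only [h.not_gt, h.not_ge, if_false]; ring
    · simp only [le_refl, lt_irrefl, if_true, if_false]; ring
    · simp only [h.le, h, if_true]; ring
  · rcases lt_trichotomy p q with h | rfl | h
    · simp only [h.le, h, h.not_gt, h.not_ge, if_true, if_false]; ring
    · simp only [le_refl, lt_irrefl, if_true, if_false]; ring
    · simp only [h.le, h, h.not_gt, h.not_ge, if_true, if_false]; ring
  · rcases lt_trichotomy p q with h | h | h <;>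
    rcases lt_trichotomy p b with h' | h' | h' <;>
    rcases lt_trichotomy q b with h'' | h'' | h'' <;>
    first
      | (exfalso; order)
      | (subst_vars
         simp only [*, le_refl, lt_irrefl, if_true, if_false, le_of_lt, not_lt_of_gt,
          not_le_of_gt]
         ring)

end YangBaxter

/-! ### Transfer matrices of rows -/

section Rows

variable {n m : ℕ} {R : Type*} [CommRing R]

/-- The transfer matrix of a row with label `l` on its left edge and `0` on its right edge, from
the labels `V` of the edges above the row to the labels `V'` of the edges below it. -/
noncomputable def rowMatrix (m : ℕ) (β z : R) (l : EdgeLabel n) :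
    Matrix (Fin m → EdgeLabel n) (Fin m → EdgeLabel n) R :=
  Matrix.of fun V V' => (List.ofFn fun k => vertexMatrix β z (V k) (V' k)).prod l none

theorem rowMatrix_apply (β z : R) (l : EdgeLabel n) (V V' : Fin m → EdgeLabel n) :
    rowMatrix m β z l V V' = ∑ h : Fin (m + 1) → EdgeLabel n,
      if h 0 = l ∧ h (Fin.last m) = none then
        ∏ k, vertexWeight β z (h k.castSucc) (V k) (h k.succ) (V' k) else 0 := by
  simp [rowMatrix, prod_ofFn_apply, vertexMatrix]

/-- Two consecutive rows, read column by column. -/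
theorem rowMatrix_mul_rowMatrix_apply (β x y : R) (p q : EdgeLabel n)
    (V V' : Fin m → EdgeLabel n) :
    (rowMatrix m β x p * rowMatrix m β y q) V V' =
      (List.ofFn fun k => columnMatrix β x y (V k) (V' k)).prod (p, q) (none, none) := by
  simp only [columnMatrix]
  rw [← sum_prod_ofFn (fun (k : Fin m) c => Matrix.kroneckerMap (· * ·)
    (vertexMatrix β x (V k) c) (vertexMatrix β y c (V' k))), Matrix.sum_apply, Matrix.mul_apply]
  refine Finset.sum_congr rfl fun U _ => ?_
  rw [← prod_ofFn_kronecker]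
  simp [rowMatrix]

/-- The train argument: the R-matrix attached to the left of two rows is moved through all columns
by the Yang–Baxter equation.  At the right edges, where both labels are `0`, it acts by the scalar
`y (1 + β x)`. -/
theorem rowMatrix_mul_rowMatrix_exchange (β x y : R) {i j : Fin n} (hij : i < j) :
    (y * (1 + β * x)) • (rowMatrix m β y (some j) * rowMatrix m β x (some i)) =
      (y * (1 + β * x)) • (rowMatrix m β x (some j) * rowMatrix m β y (some i)) +
        (y - x) • (rowMatrix m β x (some i) * rowMatrix m β y (some j)) := by
  ext V V'
  have h := congrFun (congrFun (SemiconjBy.prod_ofFn (r := rMatrix n β x y)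
    fun k : Fin m => yangBaxter β x y (V k) (V' k)).eq (some j, some i)) (none, none)
  rw [rMatrix_mul_apply, Matrix.mul_apply, Fintype.sum_prod_type] at h
  simp only [Matrix.add_apply, Matrix.smul_apply, smul_eq_mul, rowMatrix_mul_rowMatrix_apply]
  simp only [rPassWeight, rTurnWeight, hij.le, hij, if_true] at h
  rw [h, Finset.sum_eq_single none, Finset.sum_eq_single none]
  · simp [rMatrix, rPassWeight, rTurnWeight, labelDelta, mul_comm]
  · intro s _ hs
    simp [rMatrix, labelDelta, hs.symm]
  · simp
  · intro r _ hr
    refine Finset.sum_eq_zero fun s _ => ?_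
    rcases r with _ | r
    · exact absurd rfl hr
    · rcases s with _ | s <;> simp [rMatrix, labelDelta]
  · simp

/-- The colors occupy the top columns from left to right in decreasing order. -/
theorem strictMono_topColumn {lam : Fin n → ℕ} (hlam : Antitone lam) :
    StrictMono fun i : Fin n => lam i.rev + (i : ℕ) := fun _ _ hij =>
  add_lt_add_of_le_of_lt (hlam (Fin.rev_le_rev.mpr hij.le)) hij

open Classical in
/-- The labels on the vertical edges above row `r` in the unique state for `w = 1`: only the
colors that enter at row `r` or below it occur, each in its top column. -/
noncomputable def groundRow (lam : Fin n → ℕ) (m r : ℕ) (k : Fin m) : EdgeLabel n :=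
  if h : ∃ i : Fin n, (k : ℕ) = lam i.rev + i ∧ i + r < n then some h.choose else none

theorem groundRow_eq_some {lam : Fin n → ℕ} (hlam : Antitone lam) {r : ℕ} {k : Fin m} {i : Fin n} :
    groundRow lam m r k = some i ↔ (k : ℕ) = lam i.rev + i ∧ i + r < n := by
  unfold groundRow
  split_ifs with h
  · constructor
    · intro e
      rw [← Option.some_injective _ e]
      exact h.choose_spec
    · intro hi
      rw [(strictMono_topColumn hlam).injective (h.choose_spec.1.symm.trans hi.1)]
  · exact ⟨fun e => by simp at e, fun hi => (h ⟨i, hi⟩).elim⟩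

/-- The partition function as a product of transfer matrices. -/
theorem partitionFunction_coloredStates_eq {lam : Fin n → ℕ} (hlam : Antitone lam)
    (w : Equiv.Perm (Fin n)) (z : Fin n → R) (β : R) :
    partitionFunction (coloredStates m lam w) z β =
      (List.ofFn fun r => rowMatrix m β (z r)
        (permuteSeq (w * Fin.revPerm) (fun i : Fin n => (some i : EdgeLabel n)) r)).prod
        (groundRow lam m 0) (fun _ => none) := by
  classical
  set ℓ := permuteSeq (w * Fin.revPerm) (fun i : Fin n => (some i : EdgeLabel n))
  have htop : ∀ V : Fin m → EdgeLabel n,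
      (∀ (k : Fin m) (i : Fin n), V k = some i ↔ (k : ℕ) = lam i.rev + i) ↔
        V = groundRow lam m 0 := by
    intro V
    constructor
    · intro h
      ext k i
      rw [h, groundRow_eq_some hlam]
      simp
    · rintro rfl k i
      rw [groundRow_eq_some hlam]
      simp
  rw [prod_ofFn_apply, partitionFunction, coloredStates, Finset.sum_filter,
    Fintype.sum_prod_type_right]
  refine Finset.sum_congr rfl fun V _ => ?_
  simp only [rowMatrix_apply]
  rw [Finset.prod_univ_sum]
  simp only [Fintype.piFinset_univ]
  split_ifs with hV
  -- inadmissible labelings contribute `0`, as one of their vertices has weight `0`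
  · refine Finset.sum_congr rfl fun H _ => ?_
    by_cases hH : ∀ r, H r 0 = ℓ r ∧ H r (Fin.last m) = none
    · rw [Finset.prod_congr rfl fun r _ => if_pos (hH r)]
      by_cases hA : IsAdmissible (H, V)
      · rw [if_pos]
        · rfl
        · exact ⟨⟨fun r => (hH r).1, fun r => (hH r).2, fun k => congrFun hV.2 k,
            (htop _).mpr hV.1⟩, hA⟩
      · rw [if_neg fun h => hA h.2]
        simp only [IsAdmissible, not_forall] at hA
        obtain ⟨r, k, hrk⟩ := hA
        exact (Finset.prod_eq_zero (Finset.mem_univ r) (Finset.prod_eq_zero (Finset.mem_univ k)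
          (if_neg hrk))).symm
    · rw [if_neg fun h => hH fun r => ⟨h.1.1 r, h.1.2.1 r⟩]
      obtain ⟨r, hr⟩ := not_forall.mp hH
      exact (Finset.prod_eq_zero (Finset.mem_univ r) (if_neg hr)).symm
  · refine Finset.sum_eq_zero fun H _ => if_neg fun h => hV ?_
    exact ⟨(htop _).mp h.1.2.2.2, funext h.1.2.2.1⟩

theorem map_partitionFunction {S : Type*} [CommRing S] (φ : R →+* S)
    (model : Finset (Labeling n m)) (z : Fin n → R) (β : R) :
    φ (partitionFunction model z β) = partitionFunction model (fun r => φ (z r)) (φ β) := by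
  simp only [partitionFunction, stateWeight, map_sum, map_prod, vertexWeight, apply_ite φ, map_add,
    map_mul, map_one, map_zero]

end Rows

/-! ### The unique state for the identity -/

section Ground

variable {n m : ℕ} {R : Type*} [CommRing R]

theorem groundRow_succ {lam : Fin n → ℕ} (hlam : Antitone lam) (r : Fin n) (k : Fin m) :
    groundRow lam m (r + 1) k =
      if (k : ℕ) = lam r + r.rev then none else groundRow lam m r k := by
  have hinj := (strictMono_topColumn hlam).injective
  ext i
  rw [groundRow_eq_some hlam]
  split_ifs with hk
  · simp only [iff_false, not_and, not_lt]
    intro hi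
    have : i = r.rev := hinj (by simpa using hi.symm.trans hk)
    subst this
    rw [Fin.val_rev]; omega
  · rw [groundRow_eq_some hlam]
    refine and_congr_right fun hi => ⟨fun h => by omega, fun h => ?_⟩
    have : (i : ℕ) ≠ r.rev := fun e => hk (by
      have : i = r.rev := Fin.ext e
      subst this
      simpa using hi)
    rw [Fin.val_rev] at this
    omega

theorem groundRow_eq_none_of_lt {lam : Fin n → ℕ} (hlam : Antitone lam) (r : Fin n) {k : Fin m}
    (hk : lam r + r.rev < k) : groundRow lam m r k = none := by
  rw [Option.eq_none_iff_forall_ne_some]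
  intro i hi
  rw [groundRow_eq_some hlam] at hi
  have hir : i ≤ r.rev := by rw [Fin.le_def, Fin.val_rev]; omega
  have := (strictMono_topColumn hlam).monotone hir
  simp only [Fin.rev_rev] at this
  omega

theorem groundRow_eq_some_rev {lam : Fin n → ℕ} (hlam : Antitone lam) (r : Fin n) {k : Fin m} :
    groundRow lam m r k = some r.rev ↔ (k : ℕ) = lam r + r.rev := by
  rw [groundRow_eq_some hlam, Fin.rev_rev, and_iff_left]
  rw [Fin.val_rev]; omega

theorem lt_rev_of_groundRow_eq_some {lam : Fin n → ℕ} (hlam : Antitone lam) (r : Fin n) {k : Fin m}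
    (hk : (k : ℕ) < lam r + r.rev) {i : Fin n} (h : groundRow lam m r k = some i) : i < r.rev := by
  rw [groundRow_eq_some hlam] at h
  by_contra hi
  have := (strictMono_topColumn hlam).monotone (not_lt.mp hi)
  simp only [Fin.rev_rev] at this
  omega

/-- The `lam r + r.rev` columns to the left of the color `r.rev` contain all `r.rev` larger
colors, so that `lam r` of them are empty. -/
theorem card_groundRow_eq_none {lam : Fin n → ℕ} (hlam : Antitone lam) (r : Fin n)
    (hm : lam r + n ≤ m) :
    (Finset.univ.filter fun k : Fin m =>
      (k : ℕ) < lam r + r.rev ∧ groundRow lam m r k = none).card = lam r := by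
  classical
  have hK : lam r + (r.rev : ℕ) < m := by have := r.rev.2; omega
  have h1 : (Finset.univ.filter fun k : Fin m => (k : ℕ) < lam r + r.rev).card
      = lam r + r.rev := by
    have : (Finset.univ.filter fun k : Fin m => (k : ℕ) < lam r + r.rev)
        = Finset.Iio ⟨lam r + r.rev, hK⟩ := by
      ext k; simp [Fin.lt_def]
    rw [this, Fin.card_Iio]
  have h2 : ((Finset.univ.filter fun k : Fin m => (k : ℕ) < lam r + r.rev).filter
      fun k => ¬ groundRow lam m r k = none).card = r.rev := by
    refine Eq.trans (Eq.symm ?_) (Fin.card_Iio r.rev)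
    have hlt : ∀ i ∈ Finset.Iio r.rev, lam i.rev + (i : ℕ) < lam r + r.rev := fun i hi => by
      simpa using strictMono_topColumn hlam (Finset.mem_Iio.mp hi)
    refine Finset.card_bij (fun i hi => ⟨lam i.rev + i, (hlt i hi).trans hK⟩) ?_ ?_ ?_
    · intro i hi
      rw [Finset.mem_filter, Finset.mem_filter]
      refine ⟨⟨Finset.mem_univ _, hlt i hi⟩, ?_⟩
      have hi' := Finset.mem_Iio.mp hi
      rw [Fin.lt_def, Fin.val_rev] at hi'
      rw [(groundRow_eq_some hlam (i := i)).mpr ⟨rfl, by omega⟩]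
      simp
    · intro i _ j _ e
      exact (strictMono_topColumn hlam).injective (Fin.mk.inj e)
    · intro k hk
      rw [Finset.mem_filter, Finset.mem_filter] at hk
      obtain ⟨i, hi⟩ := Option.ne_none_iff_exists'.mp hk.2
      exact ⟨i, Finset.mem_Iio.mpr (lt_rev_of_groundRow_eq_some hlam r hk.1.2 hi),
        Fin.ext ((groundRow_eq_some hlam).mp hi).1.symm⟩
  -- the empty columns are the complement of the occupied ones
  have h3 := Finset.card_filter_add_card_filter_not
    (s := Finset.univ.filter fun k : Fin m => (k : ℕ) < lam r + r.rev)
    (fun k => groundRow lam m r k = none)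
  rw [h1, h2, Finset.filter_filter] at h3
  omega

/-- The color entering a row of the ground state runs straight to the right until it meets its own
column, where it turns up: it cannot leave the row earlier, and any color on the row beyond that
column would reach the right boundary. -/
theorem horizontal_eq_of_admissible {lam : Fin n → ℕ} (hlam : Antitone lam) (r : Fin n)
    {h : Fin (m + 1) → EdgeLabel n} {V' : Fin m → EdgeLabel n}
    (h0 : h 0 = some r.rev) (hlast : h (Fin.last m) = none)
    (hadm : ∀ k : Fin m,
      AdmissibleVertex (h k.castSucc) (groundRow lam m r k) (h k.succ) (V' k)) (k : Fin (m + 1)) :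
    h k = if (k : ℕ) ≤ lam r + r.rev then some r.rev else none := by
  split_ifs with hk
  · induction k using Fin.induction with
    | zero => exact h0
    | succ k ih =>
      rw [Fin.val_succ] at hk
      have hl := ih (by rw [Fin.val_castSucc]; omega)
      have ht : groundRow lam m r k ≠ some r.rev := fun e => by
        rw [groundRow_eq_some_rev hlam] at e; omega
      have := (admissibleVertex_iff _ _ _ _).mp (hadm k)
      rw [hl] at this
      grind
  · induction k using Fin.reverseInduction with
    | last => exact hlast
    | cast k ih =>
      rw [Fin.val_castSucc] at hk
      have hr := ih (by rw [Fin.val_succ]; omega)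
      have := (admissibleVertex_iff _ _ _ _).mp (hadm k)
      rw [hr, groundRow_eq_none_of_lt hlam r (not_le.mp hk)] at this
      grind

/-- The weights of the vertices of row `r` along the forced horizontal labels. -/
theorem vertexWeight_groundRow {lam : Fin n → ℕ} (hlam : Antitone lam) (r : Fin n) (β z : R)
    (k : Fin m) (b : EdgeLabel n) :
    vertexWeight β z (if (k : ℕ) ≤ lam r + r.rev then some r.rev else none) (groundRow lam m r k)
        (if (k : ℕ) + 1 ≤ lam r + r.rev then some r.rev else none) b =
      if b = groundRow lam m (r + 1) k then
        if (k : ℕ) < lam r + r.rev ∧ groundRow lam m r k = none then z else 1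
      else 0 := by
  rw [groundRow_succ hlam, vertexWeight_eq]
  rcases lt_trichotomy (k : ℕ) (lam r + r.rev) with hk | hk | hk
  · rw [if_pos hk.le, if_pos (Nat.succ_le_of_lt hk), if_neg hk.ne]
    rcases ht : groundRow lam m r k with _ | i
    · rcases b with _ | b <;> simp [passWeight, turnWeight, labelDelta, hk, -Fin.val_rev]
    · have hi := lt_rev_of_groundRow_eq_some hlam r hk ht
      rcases b with _ | b
      · simp [passWeight, turnWeight, labelDelta]
      · simp only [passWeight, turnWeight, labelDelta]
        grind
  · rw [if_pos hk.le, if_neg (by omega), if_pos hk, (groundRow_eq_some_rev hlam r).mpr hk]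
    rcases b with _ | b <;> simp [passWeight, turnWeight, labelDelta]
  · rw [if_neg hk.not_ge, if_neg (by omega : ¬ (k : ℕ) + 1 ≤ lam r + r.rev), if_neg hk.ne',
      groundRow_eq_none_of_lt hlam r hk]
    rcases b with _ | b <;> simp [passWeight, turnWeight, labelDelta, hk.not_gt, -Fin.val_rev]

/-- Row `r` of the ground state is forced and has weight `z_r ^ λ_r`. -/
theorem rowMatrix_groundRow {lam : Fin n → ℕ} (hlam : Antitone lam) (r : Fin n)
    (hm : lam r + n ≤ m) (β z : R) (V' : Fin m → EdgeLabel n) :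
    rowMatrix m β z (some r.rev) (groundRow lam m r) V' =
      if V' = groundRow lam m (r + 1) then z ^ lam r else 0 := by
  classical
  have hK : lam r + (r.rev : ℕ) < m := by have := r.rev.2; omega
  rw [rowMatrix_apply, Finset.sum_eq_single
    fun k : Fin (m + 1) => if (k : ℕ) ≤ lam r + r.rev then some r.rev else none]
  · rw [if_pos ⟨by simp, if_neg (by rw [Fin.val_last]; omega)⟩]
    simp only [Fin.val_castSucc, Fin.val_succ, vertexWeight_groundRow hlam]
    split_ifs with hV
    · subst hV
      simp only [if_true]
      rw [Finset.prod_ite, Finset.prod_const_one, mul_one, Finset.prod_const,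
        card_groundRow_eq_none hlam r hm]
    · obtain ⟨k, hk⟩ := Function.ne_iff.mp hV
      exact Finset.prod_eq_zero (Finset.mem_univ k) (if_neg hk)
  · intro h _ hne
    split_ifs with hb
    · by_contra hprod
      refine hne (funext (horizontal_eq_of_admissible (V' := V') hlam r hb.1 hb.2 fun k => ?_))
      by_contra hk
      exact hprod (Finset.prod_eq_zero (Finset.mem_univ k) (if_neg hk))
    · rfl
  · simp

/-- A product of matrices along a path such that each matrix sends each basis vector of the path
to a multiple of the next one. -/
theorem prod_ofFn_apply_of_path {I : Type*} [Fintype I] [DecidableEq I] {k : ℕ}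
    (M : Fin k → Matrix I I R) (v : ℕ → I) (c : Fin k → R)
    (hM : ∀ r j, M r (v r) j = if j = v (r + 1) then c r else 0) :
    (List.ofFn M).prod (v 0) (v k) = ∏ r, c r := by
  induction k generalizing v with
  | zero => simp
  | succ k ih =>
    rw [List.ofFn_succ, List.prod_cons, Matrix.mul_apply, Fin.prod_univ_succ,
      ← ih (fun r => M r.succ) (fun t => v (t + 1)) (fun r => c r.succ)
        (fun r j => by simpa using hM r.succ j)]
    have h0 : ∀ j, M 0 (v 0) j = if j = v 1 then c 0 else 0 := by simpa using hM 0
    simp [h0]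

theorem partitionFunction_coloredStates_one {lam : Fin n → ℕ} (hlam : Antitone lam)
    (hm : ∀ i, lam i + n ≤ m) (z : Fin n → R) (β : R) :
    partitionFunction (coloredStates m lam 1) z β = ∏ r, z r ^ lam r := by
  have hbot : (fun _ => none : Fin m → EdgeLabel n) = groundRow lam m n := by
    funext k
    symm
    rw [Option.eq_none_iff_forall_ne_some]
    intro i hi
    have := ((groundRow_eq_some hlam).mp hi).2
    omega
  rw [partitionFunction_coloredStates_eq hlam, hbot]
  refine prod_ofFn_apply_of_path _ (groundRow lam m) _ fun r V' => ?_
  rw [← rowMatrix_groundRow hlam r (hm r) β]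
  simp [permuteSeq, Fin.revPerm]

end Ground

/-! ### The recursion of the partition functions -/

/-- Multiplying `w` by a simple transposition that creates an inversion interchanges two left
boundary labels, the larger of which moves up; on partition functions, this is `ϖ̄_i`. -/
theorem atomOperator_partitionFunction {n m : ℕ} {lam : Fin n → ℕ} (hlam : Antitone lam)
    (i : Fin (n - 1)) (u : Equiv.Perm (Fin n))
    (hu : u⁻¹ ⟨i.1, by omega⟩ < u⁻¹ ⟨i.1 + 1, by omega⟩) :
    atomOperator i (partitionFunction (coloredStates m lam u) (fun j => (X j : BetaPoly n))
        (betaVar n)) =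
      partitionFunction (coloredStates m lam (simpleTransposition i * u))
        (fun j => (X j : BetaPoly n)) (betaVar n) := by
  have hi : i.1 + 1 < n := by omega
  set Z := partitionFunction (coloredStates m lam u) (fun j => (X j : BetaPoly n)) (betaVar n)
    with hZ
  set Z' := partitionFunction (coloredStates m lam (simpleTransposition i * u))
    (fun j => (X j : BetaPoly n)) (betaVar n) with hZ'
  have hne : zLeft i - zRight i ≠ 0 := by
    rw [sub_ne_zero]
    intro e
    have := X_injective e
    simp at this
  have hswap : swapVars i Z = partitionFunction (coloredStates m lam u)
      (fun j => (X (simpleTransposition i j) : BetaPoly n)) (betaVar n) := by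
    have := map_partitionFunction (rename (simpleTransposition i) :
      BetaPoly n →ₐ[Polynomial ℤ] BetaPoly n).toRingHom (coloredStates m lam u)
      (fun j => (X j : BetaPoly n)) (betaVar n)
    simpa [betaVar, swapVars, hZ] using this
  have hl : simpleTransposition i ⟨i.1, by omega⟩ = ⟨i.1 + 1, hi⟩ := by simp [simpleTransposition]
  have hr : simpleTransposition i ⟨i.1 + 1, hi⟩ = ⟨i.1, by omega⟩ := by simp [simpleTransposition]
  have hfix : ∀ j : Fin n, j.1 ≠ i.1 → j.1 ≠ i.1 + 1 → simpleTransposition i j = j :=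
    fun j h1 h2 => Equiv.swap_apply_of_ne_of_ne (by simpa [Fin.ext_iff]) (by simpa [Fin.ext_iff])
  have hinv : (simpleTransposition i)⁻¹ = simpleTransposition i := by simp [simpleTransposition]
  -- the train argument with `x = z_i`, `y = z_{i+1}`
  have key : (zRight i * (1 + betaVar n * zLeft i)) • swapVars i Z =
      (zRight i * (1 + betaVar n * zLeft i)) • Z + (zRight i - zLeft i) • Z' := by
    rw [hswap, hZ, hZ']
    simp only [partitionFunction_coloredStates_eq hlam]
    have := smul_prod_ofFn_of_adjacent i.1 hi
      (fun r => rowMatrix m (betaVar n) (X (simpleTransposition i r))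
        (permuteSeq (u * Fin.revPerm) (fun j : Fin n => (some j : EdgeLabel n)) r))
      (fun r => rowMatrix m (betaVar n) (X r)
        (permuteSeq (u * Fin.revPerm) (fun j : Fin n => (some j : EdgeLabel n)) r))
      (fun r => rowMatrix m (betaVar n) (X r)
        (permuteSeq (simpleTransposition i * u * Fin.revPerm)
          (fun j : Fin n => (some j : EdgeLabel n)) r))
      (zRight i * (1 + betaVar n * zLeft i)) (zRight i * (1 + betaVar n * zLeft i))
      (zRight i - zLeft i)
      (fun j h1 h2 => by rw [hfix j h1 h2])
      (fun j h1 h2 => by simp [permuteSeq, mul_inv_rev, hinv, hfix j h1 h2])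
      (by
        simp only [permuteSeq, mul_inv_rev, Equiv.Perm.mul_apply, hinv, hl, hr]
        exact rowMatrix_mul_rowMatrix_exchange (betaVar n) _ _ (Fin.rev_lt_rev.mpr hu))
    have := congrFun (congrFun this (groundRow lam m 0)) (fun _ => none)
    simpa only [Matrix.add_apply, Matrix.smul_apply] using this
  refine mul_left_cancel₀ hne ?_
  rw [atomOperator, mul_sub, demazureLascoux_spec]
  simp only [smul_eq_mul] at key
  linear_combination -key

theorem atomOperatorWord_zPow {n m : ℕ} {lam : Fin n → ℕ} (hlam : Antitone lam)
    (hm : ∀ i, lam i + n ≤ m) (ω : List (Fin (n - 1))) (w : Equiv.Perm (Fin n))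
    (hω : IsReducedExpression ω w) :
    atomOperatorWord ω (zPow lam) =
      partitionFunction (coloredStates m lam w) (fun i : Fin n => (X i : BetaPoly n))
        (betaVar n) := by
  induction ω generalizing w with
  | nil =>
    obtain rfl : 1 = w := by simpa using hω.1
    rw [partitionFunction_coloredStates_one hlam hm]
    rfl
  | cons i ω ih =>
    obtain ⟨u, hu, rfl, hlt⟩ := hω.of_cons
    rw [← atomOperator_partitionFunction hlam i u hlt, ← ih u hu]
    rfl

/-- For every partition `λ = (λ₁ ≥ ⋯ ≥ λ_n ≥ 0)`, every grid wide enough for `λ`, and every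
`w ∈ S_n`, the Lascoux atom (which does not depend on the reduced expression of `w` used to
compute it) is the partition function of the colored five-vertex model. -/
theorem mainTheorem1 (n m : ℕ) (lam : Fin n → ℕ) (hlam : Antitone lam)
    (hm : ∀ i, lam i + n ≤ m) (w : Equiv.Perm (Fin n)) :
    lascouxAtom lam w =
        partitionFunction (coloredStates m lam w) (fun i : Fin n => (X i : BetaPoly n))
          (betaVar n) ∧
      ∀ ω : List (Fin (n - 1)), IsReducedExpression ω w →
        atomOperatorWord ω (zPow lam) = lascouxAtom lam w := by
  have h := atomOperatorWord_zPow hlam hm _ w (exists_isReducedExpression w).choose_spec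
  exact ⟨h, fun ω hω => (atomOperatorWord_zPow hlam hm ω w hω).trans h.symm⟩
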